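/- For a field $\mathbb F$, a matrix $A\in\mathbb F^{n\times n}$ and a real $r\ge 0$, let $R^{rc}_{\mathbb F}(A,r)$ (the row-column rigidity) be the minimal $t$ for which there is $Z\in\mathbb F^{n\times n}$ with $\operatorname{rank}(A-Z)\le r$ such that every row and every column of $Z$ has at most $t$ non-zero entries. There is an absolute constant $C>0$ such that for all real $0<\varepsilon\le 1$, $0<c\le 1$ and every integer $d\ge 2$ there exists $$\gamma \;\ge\; C\cdot\frac{c\,\varepsilon^{2}}{d\,\log d\,\log(2/c)\,\log^{2}\!\big(2/(c\varepsilon)\big)}$$ with the following property. Let $\mathbb F$ be any field, let $k\ge 0$, and let $M_1,\dots,M_k$ be matrices with $M_i\in\mathbb F^{d_i\times d_i}$ and $cd\le d_i\le d$ for all $i$. Put $M=\bigotimes_{i=1}^k M_i$ and $n=\prod_{i=1}^k d_i$. If $n\ge d^{1/\gamma}$, then $$R^{rc}_{\mathbb F}\big(M,n^{1-\gamma}\big)\le n^{\varepsilon}.$$ -/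

import Mathlib

/-- The Kronecker product `⨂ i, M i` of finitely many square matrices; its rows and columns are
indexed by tuples `x` with `x i ∈ Fin (d i)`, so it has `∏ i, d i` rows and columns. -/
def kroneckerProd {F : Type*} [CommSemiring F] {k : ℕ} {d : Fin k → ℕ}
    (M : ∀ i, Matrix (Fin (d i)) (Fin (d i)) F) :
    Matrix (∀ i, Fin (d i)) (∀ i, Fin (d i)) F :=
  Matrix.of fun x y => ∏ i, M i (x i) (y i)

/-- Every row and every column of `Z` has at most `t` nonzero entries. -/
def RowColSparse {F ι : Type*} [Zero F] (Z : Matrix ι ι F) (t : ℕ) : Prop :=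
  (∀ i, {j | Z i j ≠ 0}.ncard ≤ t) ∧ (∀ j, {i | Z i j ≠ 0}.ncard ≤ t)

/-- Row-column rigidity of `A` over `F` for the (real) target rank `r`: the minimal `t` such that
`A` can be brought to rank at most `r` by subtracting a matrix over `F` with at most `t` nonzero
entries in every row and column. For `r ≥ 0` such a `t` exists, see `rcRigidity_set_nonempty`. -/
noncomputable def rcRigidity {F ι : Type*} [Field F] [Fintype ι]
    (A : Matrix ι ι F) (r : ℝ) : ℕ :=
  sInf {t : ℕ | ∃ Z : Matrix ι ι F, ((A - Z).rank : ℝ) ≤ r ∧ RowColSparse Z t}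

theorem rcRigidity_set_nonempty {F ι : Type*} [Field F] [Fintype ι]
    (A : Matrix ι ι F) {r : ℝ} (hr : 0 ≤ r) :
    {t : ℕ | ∃ Z : Matrix ι ι F, ((A - Z).rank : ℝ) ≤ r ∧ RowColSparse Z t}.Nonempty :=
  ⟨Nat.card ι, A, by simpa using hr,
    fun _ => Set.ncard_le_card _, fun _ => Set.ncard_le_card _⟩

/-! Every matrix of size at most `2 ^ l` is a product of `4 * l` factors supported on the diagonal
and one block `S × Sᶜ`, interleaved with submonomial matrices (`blockFactors_all`, by recursive
block LU). Kronecker products respect this factorization, and under multiplication rank errors add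
while sparsities multiply (`HasRC.mul`). It is therefore enough to treat a Kronecker product of
block factors.

There a nonzero entry `(x, y)` has, in each coordinate, `x i = y i` or `x i ∈ S i`, `y i ∉ S i`. Its
Hamming distance is thus the number of `i` with `x i ∈ S i` minus the number with `y i ∈ S i`. Both
counts concentrate around the same mean, so deleting few atypical rows and columns leaves only
entries in a small Hamming ball (`hasRC_kroneckerProd_of_offDiagBlock`).

As `l` is of order `log d`, this gives `γ` of order `ε² / (log⁴ d · log² (2 / ε))`, which dominates
the claimed bound. -/

open Matrix

/-! ### Calculus of non-rigidity. -/

/-- `A` differs by a matrix of rank at most `r` from a matrix with at most `t` nonzero entries in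
every row and every column. -/
def HasRC {F ι : Type*} [Field F] [Fintype ι] (A : Matrix ι ι F) (r t : ℝ) : Prop :=
  ∃ Z : Matrix ι ι F, ((A - Z).rank : ℝ) ≤ r ∧
    (∀ i, ({j | Z i j ≠ 0}.ncard : ℝ) ≤ t) ∧ (∀ j, ({i | Z i j ≠ 0}.ncard : ℝ) ≤ t)

theorem HasRC.rcRigidity_le {F ι : Type*} [Field F] [Fintype ι] {A : Matrix ι ι F} {r t : ℝ}
    (h : HasRC A r t) (ht : 0 ≤ t) : (rcRigidity A r : ℝ) ≤ t := by
  obtain ⟨Z, hZ, hr, hc⟩ := h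
  refine le_trans ?_ (Nat.floor_le ht)
  have : rcRigidity A r ≤ ⌊t⌋₊ :=
    Nat.sInf_le ⟨Z, hZ, fun i => Nat.le_floor (hr i), fun j => Nat.le_floor (hc j)⟩
  exact_mod_cast this

theorem HasRC.mono {F ι : Type*} [Field F] [Fintype ι] {A : Matrix ι ι F} {r t r' t' : ℝ}
    (h : HasRC A r t) (hr : r ≤ r') (ht : t ≤ t') : HasRC A r' t' := by
  obtain ⟨Z, hZ, h1, h2⟩ := h
  exact ⟨Z, hZ.trans hr, fun i => (h1 i).trans ht, fun i => (h2 i).trans ht⟩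

theorem ncard_biUnion_le_mul {ι : Type*} [Finite ι] (S : Set ι) (T : ι → Set ι) {a b : ℝ}
    (ha : (S.ncard : ℝ) ≤ a) (hb : ∀ i, ((T i).ncard : ℝ) ≤ b) (hb0 : 0 ≤ b) :
    ((⋃ i ∈ S, T i).ncard : ℝ) ≤ a * b := by
  classical
  have := Fintype.ofFinite ι
  have h : (⋃ i ∈ S, T i) = ((S.toFinset.biUnion fun i => (T i).toFinset : Finset ι) : Set ι) := by
    ext; simp
  rw [h, Set.ncard_coe_finset]
  calc (((S.toFinset.biUnion fun i => (T i).toFinset).card : ℕ) : ℝ)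
      ≤ ((∑ i ∈ S.toFinset, ((T i).toFinset).card : ℕ) : ℝ) := by
        exact_mod_cast Finset.card_biUnion_le
    _ = ∑ i ∈ S.toFinset, ((T i).ncard : ℝ) := by
        push_cast
        simp [Set.ncard_eq_toFinset_card']
    _ ≤ ∑ i ∈ S.toFinset, b := Finset.sum_le_sum fun i _ => hb i
    _ = (S.ncard : ℝ) * b := by
        rw [Finset.sum_const, nsmul_eq_mul, Set.ncard_eq_toFinset_card']
    _ ≤ a * b := by gcongr

theorem exists_ne_zero_of_mul_apply_ne_zero {R l m n : Type*} [NonUnitalNonAssocSemiring R]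
    [Fintype m] {A : Matrix l m R} {B : Matrix m n R} {i : l} {k : n} (h : (A * B) i k ≠ 0) :
    ∃ j, A i j ≠ 0 ∧ B j k ≠ 0 := by
  rw [Matrix.mul_apply] at h
  obtain ⟨j, -, hj⟩ := Finset.exists_ne_zero_of_sum_ne_zero h
  exact ⟨j, left_ne_zero_of_mul hj, right_ne_zero_of_mul hj⟩

theorem Matrix.rank_add_le_add {F m n : Type*} [Field F] [Fintype m] [Fintype n]
    (A B : Matrix m n F) : (A + B).rank ≤ A.rank + B.rank := by
  unfold Matrix.rank
  rw [Matrix.mulVecLin_add]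
  exact (Submodule.finrank_mono (LinearMap.range_add_le _ _)).trans
    (Submodule.finrank_add_le_finrank_add_finrank _ _)

/-- Replacing one factor at a time costs the rank error of that factor only, since multiplying by
another matrix does not raise rank. -/
theorem HasRC.mul {F ι : Type*} [Field F] [Fintype ι] {A B : Matrix ι ι F}
    {r t r' t' : ℝ} (hA : HasRC A r t) (hB : HasRC B r' t') (ht : 0 ≤ t) (ht' : 0 ≤ t') :
    HasRC (A * B) (r + r') (t * t') := by
  obtain ⟨Z, hZ, h1, h2⟩ := hA
  obtain ⟨W, hW, h3, h4⟩ := hB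
  refine ⟨Z * W, ?_, fun i => ?_, fun j => ?_⟩
  · have h : A * B - Z * W = (A - Z) * B + Z * (B - W) := by noncomm_ring
    rw [h]
    refine le_trans ?_ (add_le_add hZ hW)
    exact_mod_cast (Matrix.rank_add_le_add _ _).trans
      (add_le_add (Matrix.rank_mul_le_left _ _) (Matrix.rank_mul_le_right _ _))
  · refine le_trans ?_ (ncard_biUnion_le_mul {j | Z i j ≠ 0} (fun j => {k | W j k ≠ 0})
      (h1 i) h3 ht')
    refine Nat.cast_le.2 (Set.ncard_le_ncard (fun k hk => ?_) (Set.toFinite _))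
    obtain ⟨j, hj, hj'⟩ := exists_ne_zero_of_mul_apply_ne_zero hk
    simp only [Set.mem_iUnion]
    exact ⟨j, hj, hj'⟩
  · rw [mul_comm t]
    refine le_trans ?_ (ncard_biUnion_le_mul {k | W k j ≠ 0} (fun k => {i | Z i k ≠ 0})
      (h4 j) h2 ht)
    refine Nat.cast_le.2 (Set.ncard_le_ncard (fun k hk => ?_) (Set.toFinite _))
    obtain ⟨i, hZi, hWi⟩ := exists_ne_zero_of_mul_apply_ne_zero hk
    simp only [Set.mem_iUnion]
    exact ⟨i, hWi, hZi⟩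

/-- Zeroing out the rows in `R` and the columns in `C` changes the rank by at most
`R.card + C.card`. -/
theorem rank_sub_erase_le {F ι : Type*} [Field F] [Fintype ι] [DecidableEq ι]
    (A : Matrix ι ι F) (R C : Finset ι) :
    (A - Matrix.of fun i j => if i ∈ R ∨ j ∈ C then 0 else A i j).rank ≤ R.card + C.card := by
  have h : (A - Matrix.of fun i j => if i ∈ R ∨ j ∈ C then 0 else A i j) =
      Matrix.diagonal (fun i => if i ∈ R then (1 : F) else 0) * A +
      (Matrix.diagonal (fun i => if i ∈ R then (0 : F) else 1) * A) *
        Matrix.diagonal (fun i => if i ∈ C then (1 : F) else 0) := by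
    ext i j
    by_cases h1 : i ∈ R <;> by_cases h2 : j ∈ C <;> simp [h1, h2]
  have hd : ∀ S : Finset ι,
      (Matrix.diagonal (fun i => if i ∈ S then (1 : F) else 0)).rank = S.card := by
    intro S
    classical
    rw [Matrix.rank_diagonal]
    simp
  rw [h]
  refine (Matrix.rank_add_le_add _ _).trans (add_le_add ?_ ?_)
  · exact (Matrix.rank_mul_le_left _ _).trans (hd R).le
  · exact (Matrix.rank_mul_le_right _ _).trans (hd C).le

theorem kroneckerProd_mul {F : Type*} [CommSemiring F] {k : ℕ} {d : Fin k → ℕ}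
    (A B : ∀ i, Matrix (Fin (d i)) (Fin (d i)) F) :
    kroneckerProd (fun i => A i * B i) = kroneckerProd A * kroneckerProd B := by
  ext x y
  simp only [kroneckerProd, Matrix.of_apply, Matrix.mul_apply, Finset.prod_univ_sum,
    Fintype.piFinset_univ, Finset.prod_mul_distrib]

/-! ### Factorization into logarithmically many block factors. -/

/-- Every row and every column of `A` has at most one nonzero entry. -/
def SubMonomial {F m n : Type*} [Zero F] (A : Matrix m n F) : Prop :=
  (∀ i j l, A i j ≠ 0 → A i l ≠ 0 → j = l) ∧ (∀ j i l, A i j ≠ 0 → A l j ≠ 0 → i = l)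

/-- All off-diagonal nonzero entries of `A` lie in the block `S × Sᶜ` for some set `S`. -/
def OffDiagBlock {F ι : Type*} [Zero F] (A : Matrix ι ι F) : Prop :=
  ∃ S : Set ι, ∀ x y, A x y ≠ 0 → x = y ∨ (x ∈ S ∧ y ∉ S)

/-- `A` is a product of `N` matrices satisfying `OffDiagBlock`, interleaved with `N + 1` matrices
satisfying `SubMonomial`. -/
def BlockFactors {F ι : Type*} [Field F] [Fintype ι] : ℕ → Matrix ι ι F → Prop
  | 0, A => SubMonomial A
  | N + 1, A => ∃ B H P, BlockFactors N B ∧ OffDiagBlock H ∧ SubMonomial P ∧ A = B * H * P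

section
variable {F ι κ : Type*} [Field F]

theorem SubMonomial.of_diagonal {F ι : Type*} [Zero F] {A : Matrix ι ι F}
    (h : ∀ i j, A i j ≠ 0 → i = j) : SubMonomial A :=
  ⟨fun _ _ _ h1 h2 => (h _ _ h1).symm.trans (h _ _ h2),
    fun _ _ _ h1 h2 => (h _ _ h1).trans (h _ _ h2).symm⟩

theorem subMonomial_one [DecidableEq ι] : SubMonomial (1 : Matrix ι ι F) :=
  .of_diagonal fun i j h => by
    by_contra hij
    exact h (Matrix.one_apply_ne hij)

theorem offDiagBlock_one [DecidableEq ι] : OffDiagBlock (1 : Matrix ι ι F) :=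
  ⟨∅, fun i j h => by
    left
    by_contra hij
    exact h (Matrix.one_apply_ne hij)⟩

theorem SubMonomial.submatrix {A : Matrix ι ι F} (hA : SubMonomial A) (e e' : κ ≃ ι) :
    SubMonomial (A.submatrix e e') :=
  ⟨fun _ _ _ h h' => e'.injective (hA.1 _ _ _ h h'),
    fun _ _ _ h h' => e.injective (hA.2 _ _ _ h h')⟩

theorem OffDiagBlock.submatrix {A : Matrix ι ι F} (hA : OffDiagBlock A) (e : κ ≃ ι) :
    OffDiagBlock (A.submatrix e e) := by
  obtain ⟨S, hS⟩ := hA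
  exact ⟨e ⁻¹' S, fun x y h => (hS _ _ h).imp (fun h => e.injective h) id⟩

theorem SubMonomial.fromBlocks {A : Matrix ι ι F} {B : Matrix κ κ F} (hA : SubMonomial A)
    (hB : SubMonomial B) : SubMonomial (Matrix.fromBlocks A 0 0 B) := by
  constructor
  · rintro (i | i) (j | j) (k | k) h h' <;> simp at h h' ⊢
    · exact hA.1 _ _ _ h h'
    · exact hB.1 _ _ _ h h'
  · rintro (i | i) (j | j) (k | k) h h' <;> simp at h h' ⊢
    · exact hA.2 _ _ _ h h'
    · exact hB.2 _ _ _ h h'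

theorem OffDiagBlock.fromBlocks {A : Matrix ι ι F} {B : Matrix κ κ F} (hA : OffDiagBlock A)
    (hB : OffDiagBlock B) : OffDiagBlock (Matrix.fromBlocks A 0 0 B) := by
  obtain ⟨S, hS⟩ := hA
  obtain ⟨T, hT⟩ := hB
  refine ⟨Sum.elim S T, ?_⟩
  rintro (i | i) (j | j) h <;> simp at h
  · exact (hS _ _ h).imp (fun h => by rw [h]) id
  · exact (hT _ _ h).imp (fun h => by rw [h]) id

theorem offDiagBlock_lower [DecidableEq ι] [DecidableEq κ] (C : Matrix κ ι F) :
    OffDiagBlock (Matrix.fromBlocks 1 0 C 1) := by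
  refine ⟨Set.range Sum.inr, ?_⟩
  rintro (i | i) (j | j) h <;> simp at h ⊢
  all_goals
    by_contra hij
    exact h (Matrix.one_apply_ne hij)

theorem offDiagBlock_upper [DecidableEq ι] [DecidableEq κ] (C : Matrix ι κ F) :
    OffDiagBlock (Matrix.fromBlocks 1 C 0 1) := by
  refine ⟨Set.range Sum.inl, ?_⟩
  rintro (i | i) (j | j) h <;> simp at h ⊢
  all_goals
    by_contra hij
    exact h (Matrix.one_apply_ne hij)

variable [Fintype ι] [Fintype κ]

theorem SubMonomial.mul {A B : Matrix ι ι F} (hA : SubMonomial A) (hB : SubMonomial B) :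
    SubMonomial (A * B) := by
  constructor
  · intro i j j' h h'
    obtain ⟨k, h1, h2⟩ := exists_ne_zero_of_mul_apply_ne_zero h
    obtain ⟨k', h1', h2'⟩ := exists_ne_zero_of_mul_apply_ne_zero h'
    obtain rfl := hA.1 i k k' h1 h1'
    exact hB.1 _ _ _ h2 h2'
  · intro i j j' h h'
    obtain ⟨k, h1, h2⟩ := exists_ne_zero_of_mul_apply_ne_zero h
    obtain ⟨k', h1', h2'⟩ := exists_ne_zero_of_mul_apply_ne_zero h'
    obtain rfl := hB.2 _ _ _ h2 h2'
    exact hA.2 _ _ _ h1 h1'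

theorem BlockFactors.mul_subMonomial {N : ℕ} {A P : Matrix ι ι F} (hA : BlockFactors N A)
    (hP : SubMonomial P) : BlockFactors N (A * P) := by
  cases N with
  | zero => exact SubMonomial.mul hA hP
  | succ N =>
    obtain ⟨B, H, Q, hB, hH, hQ, rfl⟩ := hA
    exact ⟨B, H, Q * P, hB, hH, hQ.mul hP, by simp only [Matrix.mul_assoc]⟩

theorem BlockFactors.mul {N K : ℕ} {A B : Matrix ι ι F} (hA : BlockFactors N A)
    (hB : BlockFactors K B) : BlockFactors (N + K) (A * B) := by
  induction K generalizing B with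
  | zero => exact hA.mul_subMonomial hB
  | succ K ih =>
    obtain ⟨B, H, Q, hB, hH, hQ, rfl⟩ := hB
    exact ⟨A * B, H, Q, ih hB, hH, hQ, by simp only [Matrix.mul_assoc]⟩

theorem OffDiagBlock.blockFactors {A : Matrix ι ι F} (hA : OffDiagBlock A) :
    BlockFactors 1 A := by
  classical
  exact ⟨1, A, 1, subMonomial_one, hA, subMonomial_one, by simp⟩

theorem BlockFactors.mono {N K : ℕ} {A : Matrix ι ι F} (hA : BlockFactors N A) (h : N ≤ K) :
    BlockFactors K A := by
  classical
  induction K, h using Nat.le_induction with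
  | base => exact hA
  | succ K _ ih => exact ⟨A, 1, 1, ih, offDiagBlock_one, subMonomial_one, by simp⟩

theorem BlockFactors.submatrix {N : ℕ} {A : Matrix ι ι F} (hA : BlockFactors N A)
    (e e' : κ ≃ ι) : BlockFactors N (A.submatrix e e') := by
  induction N generalizing A with
  | zero => exact SubMonomial.submatrix hA e e'
  | succ N ih =>
    obtain ⟨B, H, Q, hB, hH, hQ, rfl⟩ := hA
    exact ⟨B.submatrix e e', H.submatrix e' e', Q.submatrix e' e', ih hB, hH.submatrix e',
      hQ.submatrix e' e', by simp only [Matrix.submatrix_mul_equiv]⟩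

/-- Factoring both diagonal blocks in parallel keeps the count at `N` instead of `2 * N`; this is
what makes the recursion depth logarithmic. -/
theorem BlockFactors.fromBlocks {N : ℕ} {A : Matrix ι ι F} {B : Matrix κ κ F}
    (hA : BlockFactors N A) (hB : BlockFactors N B) :
    BlockFactors N (Matrix.fromBlocks A 0 0 B) := by
  induction N generalizing A B with
  | zero => exact SubMonomial.fromBlocks hA hB
  | succ N ih =>
    obtain ⟨A, H, P, hA, hH, hP, rfl⟩ := hA
    obtain ⟨B, K, Q, hB, hK, hQ, rfl⟩ := hB
    exact ⟨_, _, _, ih hA hB, hH.fromBlocks hK, hP.fromBlocks hQ, by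
      simp [Matrix.fromBlocks_multiply]⟩

/-- The columns of an invertible matrix can be rearranged so that a prescribed leading block
becomes invertible. -/
theorem exists_equiv_isUnit_toBlocks₁₁ {a b n : ℕ} {A : Matrix (Fin n) (Fin n) F} (hA : IsUnit A)
    (e : Fin a ⊕ Fin b ≃ Fin n) :
    ∃ e' : Fin a ⊕ Fin b ≃ Fin n, IsUnit (A.submatrix e e').toBlocks₁₁ := by
  set B : Matrix (Fin a) (Fin n) F := A.submatrix (e ∘ Sum.inl) id with hB
  have hrow : LinearIndependent F B.row :=
    (Matrix.linearIndependent_rows_iff_isUnit.2 hA).comp (e ∘ Sum.inl)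
      (e.injective.comp Sum.inl_injective)
  have hrank : B.rank = a := by simpa using hrow.rank_matrix
  -- The selected `a` rows are independent, so column rank equals row rank and some `a` columns form
  -- a basis of the column space.
  obtain ⟨κ, f, hf, hspan, hli⟩ := exists_linearIndependent' F B.col
  have : Fintype κ := Fintype.ofInjective f hf
  have hcard : Fintype.card κ = a := by
    rw [← finrank_span_eq_card hli, hspan, ← Matrix.rank_eq_finrank_span_cols, hrank]
  let g : Fin a ≃ κ := (Fintype.equivFinOfCardEq hcard).symm
  have hg : Function.Injective (f ∘ g) := hf.comp g.injective
  have hn : a + b = n := by simpa using Fintype.card_congr e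
  classical
  have hc : Fintype.card (Fin b) = Fintype.card ((Set.range (f ∘ g))ᶜ : Set (Fin n)) := by
    rw [Fintype.card_compl_set, Set.card_range_of_injective hg]
    simp
    omega
  refine ⟨(Equiv.sumCongr (Equiv.ofInjective _ hg) (Fintype.equivOfCardEq hc)).trans
    (Equiv.Set.sumCompl (Set.range (f ∘ g))), ?_⟩
  rw [← Matrix.linearIndependent_cols_iff_isUnit]
  refine (linearIndependent_equiv' (Equiv.refl _) ?_).1 (hli.comp g g.injective)
  ext i j
  simp [hB, Matrix.col, Matrix.toBlocks₁₁]
  rfl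

/-- Block LU with column pivoting: once the leading half is invertible, the matrix is lower shear,
times block diagonal with the Schur complement, times upper shear. Each halving adds only the two
shears. -/
theorem blockFactors_of_isUnit (l n : ℕ) (hn : n ≤ 2 ^ l) (A : Matrix (Fin n) (Fin n) F)
    (hA : IsUnit A) : BlockFactors (2 * l) A := by
  induction l generalizing n with
  | zero =>
    have : Subsingleton (Fin n) := Fin.subsingleton_iff_le_one.2 (by simpa using hn)
    exact SubMonomial.of_diagonal fun i j _ => Subsingleton.elim i j
  | succ l ih =>
    have ha : n / 2 ≤ 2 ^ l := by rw [pow_succ] at hn; omega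
    have hb : n - n / 2 ≤ 2 ^ l := by rw [pow_succ] at hn; omega
    have hab : n / 2 + (n - n / 2) = n := by omega
    obtain ⟨e', he'⟩ :=
      exists_equiv_isUnit_toBlocks₁₁ hA (finSumFinEquiv.trans (finCongr hab))
    set e := finSumFinEquiv.trans (finCongr hab)
    set B := A.submatrix e e' with hBdef
    suffices h : BlockFactors (2 * (l + 1)) B by
      have := h.submatrix e.symm e'.symm
      simpa [hBdef] using this
    have hB : IsUnit B := by
      rw [hBdef]
      have : A.submatrix e e' = (A * (1 : Matrix (Fin n) (Fin n) F).submatrix id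
          (e.symm.trans e')).submatrix e e := by
        ext i j
        simp [Matrix.mul_apply, Matrix.one_apply]
      rw [this, Matrix.isUnit_submatrix_equiv]
      refine hA.mul ?_
      have := (Matrix.isUnit_submatrix_equiv (A := (1 : Matrix (Fin n) (Fin n) F))
        (Equiv.refl _) (e.symm.trans e')).2 isUnit_one
      simpa using this
    let _ := he'.invertible
    have hfac := Matrix.fromBlocks_eq_of_invertible₁₁ B.toBlocks₁₁ B.toBlocks₁₂ B.toBlocks₂₁
      B.toBlocks₂₂
    have hS : IsUnit (B.toBlocks₂₂ - B.toBlocks₂₁ * ⅟B.toBlocks₁₁ * B.toBlocks₁₂) := by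
      rw [Matrix.isUnit_iff_isUnit_det] at hB ⊢
      rw [← Matrix.fromBlocks_toBlocks B, Matrix.det_fromBlocks₁₁] at hB
      exact isUnit_of_mul_isUnit_right hB
    rw [← Matrix.fromBlocks_toBlocks B, hfac]
    have h1 := (ih _ ha _ he').fromBlocks (ih _ hb _ hS)
    have h2 := ((offDiagBlock_lower (B.toBlocks₂₁ * ⅟B.toBlocks₁₁)).blockFactors.mul h1).mul
      (offDiagBlock_upper (⅟B.toBlocks₁₁ * B.toBlocks₁₂)).blockFactors
    exact h2.mono (by omega)

/-- The rank normal form is submonomial and costs nothing; the two invertible matrices around it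
cost `2 * l` each. -/
theorem blockFactors_all (l n : ℕ) (hn : n ≤ 2 ^ l) (A : Matrix (Fin n) (Fin n) F) :
    BlockFactors (4 * l) A := by
  obtain ⟨V, U, e, hV, hU, h⟩ := A.exists_rank_normal_form
  have hA : A = V⁻¹ * (V * A * U) * U⁻¹ := by
    rw [Matrix.isUnit_iff_isUnit_det] at hV hU
    rw [Matrix.mul_assoc V, Matrix.nonsing_inv_mul_cancel_left _ _ hV,
      Matrix.mul_nonsing_inv_cancel_right _ _ hU]
  have hD : BlockFactors 0 (V * A * U) := by
    rw [h]
    refine SubMonomial.submatrix (SubMonomial.fromBlocks subMonomial_one ?_) e e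
    exact ⟨by simp, by simp⟩
  rw [hA]
  have h1 := ((blockFactors_of_isUnit l n hn V⁻¹ (Matrix.isUnit_nonsing_inv_iff.2 hV)).mul hD).mul
    (blockFactors_of_isUnit l n hn U⁻¹ (Matrix.isUnit_nonsing_inv_iff.2 hU))
  exact h1.mono (by omega)

end

/-! ### Concentration and Hamming balls in product spaces. -/

theorem half_le_log_natCast {s : ℕ} (hs : 2 ≤ s) : 1 / 2 ≤ Real.log s := by
  have h1 : Real.log 2 ≤ Real.log s := Real.log_le_log (by norm_num) (by exact_mod_cast hs)
  have := Real.log_two_gt_d9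
  linarith

/-- Exponential moment bound for a centered function bounded by one on `Fin s`. -/
theorem sum_exp_mul_le {s : ℕ} (f : Fin s → ℝ) (hf : ∑ x, f x = 0) (hf1 : ∀ x, |f x| ≤ 1)
    {a : ℝ} (h0 : 0 ≤ a) (h1 : a ≤ 1) :
    ∑ x, Real.exp (a * f x) ≤ s * Real.exp (2 * a ^ 2 * Real.log s) := by
  -- For `s ≤ 1` a centered function vanishes; for `s ≥ 2` the bound `1 / 2 ≤ log s` turns `a ^ 2`
  -- into `2 * a ^ 2 * log s`.
  rcases lt_or_ge s 2 with hs | hs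
  · interval_cases s
    · simp
    · have : f 0 = 0 := by simpa using hf
      simp [this]
  · have hb : ∀ x, Real.exp (a * f x) ≤ 1 + a * f x + a ^ 2 := by
      intro x
      have habs : |a * f x| ≤ a := by
        rw [abs_mul, abs_of_nonneg h0]
        exact mul_le_of_le_one_right h0 (hf1 x)
      have h2 := (abs_le.1 (Real.abs_exp_sub_one_sub_id_le (habs.trans h1))).2
      have h3 : (a * f x) ^ 2 ≤ a ^ 2 := by
        rw [← sq_abs]
        gcongr
      linarith
    have hlog := half_le_log_natCast hs
    calc ∑ x, Real.exp (a * f x) ≤ ∑ x, (1 + a * f x + a ^ 2) :=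
          Finset.sum_le_sum fun x _ => hb x
      _ = s * (a ^ 2 + 1) := by
          simp only [Finset.sum_add_distrib, ← Finset.mul_sum, hf]
          simp
          ring
      _ ≤ s * Real.exp (2 * a ^ 2 * Real.log s) := by
          gcongr
          refine (Real.add_one_le_exp _).trans (Real.exp_le_exp.2 ?_)
          nlinarith [sq_nonneg a]

section
variable {k : ℕ} {s : Fin k → ℕ}

theorem sum_pi_prod (g : ∀ i, Fin (s i) → ℝ) :
    ∑ x : ∀ i, Fin (s i), ∏ i, g i (x i) = ∏ i, ∑ j, g i j := by
  rw [Finset.prod_univ_sum, Fintype.piFinset_univ]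

/-- Chernoff bound for a sum of independent centered variables; the deviation is measured in terms
of the logarithm of the size of the product space. -/
theorem card_large_sum_le (f : ∀ i, Fin (s i) → ℝ) (hf : ∀ i, ∑ x, f i x = 0)
    (hf1 : ∀ i x, |f i x| ≤ 1) {δ : ℝ} (h0 : 0 ≤ δ) (h1 : δ ≤ 4) :
    (((Finset.univ.filter fun x : ∀ i, Fin (s i) =>
      δ * ∑ i, Real.log (s i) ≤ ∑ i, f i (x i)).card : ℕ) : ℝ) ≤
      (∏ i, (s i : ℝ)) * Real.exp (-(δ ^ 2 / 8) * ∑ i, Real.log (s i)) := by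
  set L := ∑ i, Real.log (s i) with hL
  -- This value minimizes the exponent `2 * a ^ 2 * L - a * δ * L`, giving `-(δ ^ 2 / 8) * L`.
  set a := δ / 4 with ha
  have hsum : ∑ x : ∀ i, Fin (s i), Real.exp (a * ∑ i, f i (x i)) ≤
      (∏ i, (s i : ℝ)) * Real.exp (2 * a ^ 2 * L) := by
    simp only [Finset.mul_sum, Real.exp_sum]
    rw [sum_pi_prod fun i j => Real.exp (a * f i j), hL, Finset.mul_sum, Real.exp_sum,
      ← Finset.prod_mul_distrib]
    refine Finset.prod_le_prod (fun i _ => Finset.sum_nonneg fun x _ => (Real.exp_pos _).le)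
      fun i _ => sum_exp_mul_le (f i) (hf i) (hf1 i) (by positivity) (by linarith)
  have hmark : (((Finset.univ.filter fun x : ∀ i, Fin (s i) =>
      δ * L ≤ ∑ i, f i (x i)).card : ℕ) : ℝ) * Real.exp (a * (δ * L)) ≤
      ∑ x : ∀ i, Fin (s i), Real.exp (a * ∑ i, f i (x i)) := by
    rw [← nsmul_eq_mul]
    refine (Finset.card_nsmul_le_sum _ (fun x : ∀ i, Fin (s i) =>
      Real.exp (a * ∑ i, f i (x i))) _ ?_).trans
      (Finset.sum_le_sum_of_subset_of_nonneg (Finset.subset_univ _)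
        fun _ _ _ => (Real.exp_pos _).le)
    intro x hx
    have := (Finset.mem_filter.1 hx).2
    have ha0 : 0 ≤ a := by positivity
    gcongr
  rw [← mul_le_mul_iff_left₀ (Real.exp_pos (a * (δ * L)))]
  refine (hmark.trans hsum).trans (le_of_eq ?_)
  rw [mul_assoc (∏ i, (s i : ℝ)), ← Real.exp_add]
  congr 2
  rw [ha]
  ring

/-- Size of a Hamming ball in a product of sets of size at most `d`. -/
theorem card_hammingBall_le {d : ℕ} (hs : ∀ i, s i ≤ d) (x : ∀ i, Fin (s i))
    {t m : ℝ} (ht : 1 ≤ t) :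
    (((Finset.univ.filter fun y : ∀ i, Fin (s i) => (hammingDist x y : ℝ) ≤ m).card : ℕ) : ℝ) ≤
      t ^ m * Real.exp (2 * (d / t) * ∑ i, Real.log (s i)) := by
  have ht0 : 0 < t := by linarith
  -- The weight `t⁻¹ ^ hammingDist x y` factors over coordinates, and Markov's inequality then
  -- bounds the ball.
  have hsum : ∑ y : ∀ i, Fin (s i), t⁻¹ ^ hammingDist x y ≤
      Real.exp (2 * (d / t) * ∑ i, Real.log (s i)) := by
    have h : ∀ y : ∀ i, Fin (s i),
        t⁻¹ ^ hammingDist x y = ∏ i, if x i ≠ y i then t⁻¹ else 1 := by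
      intro y
      rw [Finset.prod_ite, Finset.prod_const, Finset.prod_const_one, mul_one]
      rfl
    simp only [h]
    rw [sum_pi_prod fun i j => if x i ≠ j then t⁻¹ else 1, Finset.mul_sum, Real.exp_sum]
    refine Finset.prod_le_prod (fun i _ => Finset.sum_nonneg fun j _ => ?_) fun i _ => ?_
    · split_ifs <;> positivity
    · have hsi : 1 ≤ s i := Nat.one_le_of_lt (x i).isLt
      have h1 : ∑ j, (if x i ≠ j then t⁻¹ else 1) = ((s i : ℝ) - 1) / t + 1 := by
        rw [← Finset.add_sum_erase _ _ (Finset.mem_univ (x i)),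
          Finset.sum_congr rfl (g := fun _ => t⁻¹) fun j hj =>
            if_pos (Finset.ne_of_mem_erase hj).symm]
        simp [Finset.card_erase_of_mem, Nat.cast_sub hsi]
        field_simp
        ring
      rw [h1]
      refine (Real.add_one_le_exp _).trans (Real.exp_le_exp.2 ?_)
      rcases lt_or_ge (s i) 2 with h2 | h2
      · have : s i = 1 := by omega
        simp [this]
      · have hlog := half_le_log_natCast h2
        have hd : (s i : ℝ) ≤ d := by exact_mod_cast hs i
        have h3 : ((s i : ℝ) - 1) / t ≤ d / t := by gcongr; linarith
        have h4 : (0 : ℝ) ≤ d / t := by positivity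
        nlinarith
  have hmark : (((Finset.univ.filter fun y : ∀ i, Fin (s i) =>
      (hammingDist x y : ℝ) ≤ m).card : ℕ) : ℝ) * t ^ (-m) ≤
      ∑ y : ∀ i, Fin (s i), t⁻¹ ^ hammingDist x y := by
    rw [← nsmul_eq_mul]
    refine (Finset.card_nsmul_le_sum _ (fun y : ∀ i, Fin (s i) =>
      t⁻¹ ^ hammingDist x y) _ ?_).trans
      (Finset.sum_le_sum_of_subset_of_nonneg (Finset.subset_univ _)
        fun _ _ _ => by positivity)
    intro y hy
    have := (Finset.mem_filter.1 hy).2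
    rw [inv_pow, ← Real.rpow_natCast, ← Real.rpow_neg ht0.le]
    exact Real.rpow_le_rpow_of_exponent_le ht (by linarith)
  have h := hmark.trans hsum
  rw [Real.rpow_neg ht0.le, ← div_eq_mul_inv, div_le_iff₀ (by positivity)] at h
  linarith

/-! ### Non-rigidity of Kronecker products of block factors. -/

/-- The Kronecker product of matrices whose off-diagonal part is supported on a block `S × Sᶜ`
is not rigid. -/
theorem hasRC_kroneckerProd_of_offDiagBlock {F : Type*} [Field F] {d : ℕ} (hs : ∀ i, s i ≤ d)
    (H : ∀ i, Matrix (Fin (s i)) (Fin (s i)) F) (hH : ∀ i, OffDiagBlock (H i))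
    {δ t : ℝ} (h0 : 0 ≤ δ) (h1 : δ ≤ 4) (ht : 1 ≤ t) :
    HasRC (kroneckerProd H)
      (2 * ((∏ i, (s i : ℝ)) * Real.exp (-(δ ^ 2 / 8) * ∑ i, Real.log (s i))))
      (t ^ (2 * δ * ∑ i, Real.log (s i)) * Real.exp (2 * (d / t) * ∑ i, Real.log (s i))) := by
  classical
  choose S hS using hH
  set L := ∑ i, Real.log (s i) with hL
  let p : Fin k → ℝ := fun i => (∑ x : Fin (s i), if x ∈ S i then (1 : ℝ) else 0) / s i
  let f : ∀ i, Fin (s i) → ℝ := fun i x => (if x ∈ S i then 1 else 0) - p i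
  have hf : ∀ i, ∑ x, f i x = 0 := by
    intro i
    rcases Nat.eq_zero_or_pos (s i) with h | h
    · have : IsEmpty (Fin (s i)) := by rw [h]; infer_instance
      simp
    · have h' : (s i : ℝ) ≠ 0 := by positivity
      simp only [f, p, Finset.sum_sub_distrib, Finset.sum_const, Finset.card_univ,
        Fintype.card_fin, nsmul_eq_mul]
      field_simp
      ring
  have hp : ∀ i, 0 ≤ p i ∧ p i ≤ 1 := by
    intro i
    refine ⟨div_nonneg (Finset.sum_nonneg fun x _ => by split_ifs <;> norm_num) (by positivity),
      div_le_one_of_le₀ ?_ (by positivity)⟩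
    calc (∑ x : Fin (s i), if x ∈ S i then (1 : ℝ) else 0) ≤ ∑ x : Fin (s i), (1 : ℝ) :=
          Finset.sum_le_sum fun x _ => by split_ifs <;> norm_num
      _ = s i := by simp
  have hf1 : ∀ i x, |f i x| ≤ 1 := by
    intro i x
    obtain ⟨h2, h3⟩ := hp i
    simp only [f]
    rw [abs_le]
    split_ifs <;> constructor <;> linarith
  -- One-sided deviations suffice: rows with too many coordinates in `S`, columns with too few.
  let R := Finset.univ.filter fun x : ∀ i, Fin (s i) => δ * L ≤ ∑ i, f i (x i)
  let C := Finset.univ.filter fun x : ∀ i, Fin (s i) => δ * L ≤ ∑ i, -f i (x i)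
  have hR := card_large_sum_le f hf hf1 h0 h1
  have hC := card_large_sum_le (fun i x => -f i x) (fun i => by simp [hf i])
    (fun i x => by simpa using hf1 i x) h0 h1
  have key : ∀ x y : ∀ i, Fin (s i),
      (if x ∈ R ∨ y ∈ C then 0 else kroneckerProd H x y) ≠ 0 →
        (hammingDist x y : ℝ) ≤ 2 * δ * L := by
    intro x y hxy
    have hmem : ¬ (x ∈ R ∨ y ∈ C) := fun h => hxy (if_pos h)
    rw [if_neg hmem] at hxy
    have hne : ∀ i, H i (x i) (y i) ≠ 0 := fun i => by
      simp only [kroneckerProd, Matrix.of_apply] at hxy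
      exact Finset.prod_ne_zero_iff.1 hxy i (Finset.mem_univ i)
    -- Memberships in `S i` differ exactly where the coordinates differ, and the means `p i` cancel.
    have hd : (hammingDist x y : ℝ) = ∑ i, f i (x i) + ∑ i, -f i (y i) := by
      rw [← Finset.sum_add_distrib, hammingDist, Finset.card_filter]
      push_cast
      refine Finset.sum_congr rfl fun i _ => ?_
      simp only [f]
      rcases hS i _ _ (hne i) with h | ⟨h, h'⟩
      · simp [h]
      · have : x i ≠ y i := fun e => h' (e ▸ h)
        simp [h, h', this]
    simp only [R, C, Finset.mem_filter, Finset.mem_univ, true_and, not_or, not_le] at hmem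
    rw [hd]
    linarith [hmem.1, hmem.2]
  refine ⟨Matrix.of fun x y => if x ∈ R ∨ y ∈ C then 0 else kroneckerProd H x y, ?_,
    fun x => ?_, fun y => ?_⟩
  · have h := rank_sub_erase_le (kroneckerProd H) R C
    have h' : ((kroneckerProd H - Matrix.of fun x y =>
      if x ∈ R ∨ y ∈ C then 0 else kroneckerProd H x y).rank : ℝ) ≤ R.card + C.card := by
      exact_mod_cast h
    linarith
  · refine le_trans ?_ (card_hammingBall_le hs x ht)
    rw [← Set.ncard_coe_finset]
    refine Nat.cast_le.2 (Set.ncard_le_ncard (fun y hy => ?_) (Set.toFinite _))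
    simpa using key x y hy
  · refine le_trans ?_ (card_hammingBall_le hs y ht)
    rw [← Set.ncard_coe_finset]
    refine Nat.cast_le.2 (Set.ncard_le_ncard (fun x hx => ?_) (Set.toFinite _))
    have := key x y hx
    rw [hammingDist_comm] at this
    simpa using this

theorem hasRC_kroneckerProd_of_subMonomial {F : Type*} [Field F]
    (P : ∀ i, Matrix (Fin (s i)) (Fin (s i)) F) (hP : ∀ i, SubMonomial (P i)) :
    HasRC (kroneckerProd P) 0 1 := by
  have hne : ∀ x y, kroneckerProd P x y ≠ 0 → ∀ i, P i (x i) (y i) ≠ 0 := fun x y h i => by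
    simp only [kroneckerProd, Matrix.of_apply] at h
    exact Finset.prod_ne_zero_iff.1 h i (Finset.mem_univ i)
  refine ⟨kroneckerProd P, by simp, fun x => ?_, fun y => ?_⟩
  · refine Nat.cast_le_one.2 ((Set.ncard_le_one (Set.toFinite _)).2 fun y hy z hz => ?_)
    exact funext fun i => (hP i).1 _ _ _ (hne _ _ hy i) (hne _ _ hz i)
  · refine Nat.cast_le_one.2 ((Set.ncard_le_one (Set.toFinite _)).2 fun x hx z hz => ?_)
    exact funext fun i => (hP i).2 _ _ _ (hne _ _ hx i) (hne _ _ hz i)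

theorem hasRC_kroneckerProd_of_blockFactors {F : Type*} [Field F] {r t : ℝ} (ht : 0 ≤ t)
    (h : ∀ H : ∀ i, Matrix (Fin (s i)) (Fin (s i)) F, (∀ i, OffDiagBlock (H i)) →
      HasRC (kroneckerProd H) r t)
    (N : ℕ) (A : ∀ i, Matrix (Fin (s i)) (Fin (s i)) F) (hA : ∀ i, BlockFactors N (A i)) :
    HasRC (kroneckerProd A) (N * r) (t ^ N) := by
  induction N generalizing A with
  | zero => simpa using hasRC_kroneckerProd_of_subMonomial A hA
  | succ N ih =>
    choose B H P hB hH hP hAB using hA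
    obtain rfl : A = fun i => B i * H i * P i := funext hAB
    rw [kroneckerProd_mul (fun i => B i * H i), kroneckerProd_mul]
    refine (((ih B hB).mul (h H hH) (by positivity) ht).mul
      (hasRC_kroneckerProd_of_subMonomial P hP) (by positivity) zero_le_one).mono ?_ ?_
    · push_cast
      linarith
    · rw [pow_succ, mul_one]

end

/-! ### Choice of parameters. -/

theorem clog_two_le_three_mul_log {d : ℕ} (hd : 2 ≤ d) : (Nat.clog 2 d : ℝ) ≤ 3 * Real.log d := by
  have h1 : 2 ^ (Nat.clog 2 d - 1) < d := Nat.pow_pred_clog_lt_self (by norm_num) (by omega)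
  have hpos : 1 ≤ Nat.clog 2 d := Nat.clog_pos (by norm_num) hd
  have h2 : Real.log ((2 : ℝ) ^ (Nat.clog 2 d - 1)) ≤ Real.log d :=
    Real.log_le_log (by positivity) (by exact_mod_cast h1.le)
  rw [Real.log_pow, Nat.cast_sub hpos, Nat.cast_one] at h2
  have h3 := Real.log_two_gt_d9
  have h4 : Real.log 2 ≤ Real.log d := Real.log_le_log (by norm_num) (by exact_mod_cast hd)
  nlinarith

theorem eight_mul_clog_two_le {d : ℕ} (hd : 2 ≤ d) : 8 * Nat.clog 2 d ≤ d ^ 4 := by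
  have h1 : 2 ^ (Nat.clog 2 d - 1) < d := Nat.pow_pred_clog_lt_self (by norm_num) (by omega)
  have h2 : Nat.clog 2 d - 1 < 2 ^ (Nat.clog 2 d - 1) := Nat.lt_two_pow_self
  have h3 : 2 ^ 3 ≤ d ^ 3 := Nat.pow_le_pow_left hd 3
  calc 8 * Nat.clog 2 d ≤ d ^ 3 * d := Nat.mul_le_mul (by omega) (by omega)
    _ = d ^ 4 := by ring

/-- A Kronecker product of matrices of size at most `d` is not rigid. -/
theorem hasRC_kroneckerProd {F : Type*} [Field F] {k d : ℕ} {s : Fin k → ℕ} (hs0 : ∀ i, 1 ≤ s i)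
    (hs : ∀ i, s i ≤ d) (hd : 2 ≤ d) (M : ∀ i, Matrix (Fin (s i)) (Fin (s i)) F) {δ ε : ℝ}
    (h0 : 0 < δ) (h1 : δ ≤ 1)
    (hε : 4 * Nat.clog 2 d * (2 * δ * (1 + Real.log (d / δ))) ≤ ε)
    (hn : (d : ℝ) ^ (1 / (δ ^ 2 / 40)) ≤ (∏ i, s i : ℕ)) :
    HasRC (kroneckerProd M) (((∏ i, s i : ℕ) : ℝ) ^ (1 - δ ^ 2 / 40))
      (((∏ i, s i : ℕ) : ℝ) ^ ε) := by
  have hd0 : (0 : ℝ) < d := by positivity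
  have hd1 : (1 : ℝ) ≤ d := by exact_mod_cast (by omega : 1 ≤ d)
  -- With `t = d / δ` each block factor has sparsity at most `n ^ (2 * δ * (1 + log (d / δ)))`.
  have ht : 1 ≤ (d : ℝ) / δ := by rw [one_le_div h0]; linarith
  set l := Nat.clog 2 d with hl
  set L := ∑ i, Real.log (s i) with hL
  have hsne : ∀ i, (s i : ℝ) ≠ 0 := fun i => by
    have := hs0 i
    positivity
  have hLn : Real.log (∏ i, (s i : ℝ)) = L := Real.log_prod fun i _ => hsne i
  have hprod : (0 : ℝ) < ∏ i, (s i : ℝ) := Finset.prod_pos fun i _ =>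
    lt_of_le_of_ne (by positivity) (hsne i).symm
  have hnL : ∏ i, (s i : ℝ) = Real.exp L := by rw [← hLn, Real.exp_log hprod]
  have hLnonneg : 0 ≤ L := Finset.sum_nonneg fun i _ => Real.log_nonneg (by exact_mod_cast hs0 i)
  have hrc := hasRC_kroneckerProd_of_blockFactors (F := F) (s := s) (by positivity)
    (fun H hH => hasRC_kroneckerProd_of_offDiagBlock hs H hH h0.le (by linarith) ht) (4 * l) M
    (fun i => blockFactors_all l (s i) ((hs i).trans (Nat.le_pow_clog (by norm_num) d)) (M i))
  push_cast at hn ⊢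
  rw [← hL, hnL] at hrc
  rw [hnL] at hn ⊢
  rw [← Real.exp_mul, ← Real.exp_mul]
  refine hrc.mono ?_ ?_
  -- The saving `δ ^ 2 / 8` is five times `δ ^ 2 / 40`: one share is kept, the other four absorb `8
  -- * l ≤ d ^ 4`.
  · have hD : Real.log d ≤ δ ^ 2 / 40 * L := by
      have := Real.log_le_log (by positivity) hn
      rw [Real.log_exp, Real.log_rpow hd0, one_div, inv_mul_le_iff₀ (by positivity)] at this
      exact this
    have h8 : (8 * l : ℝ) ≤ Real.exp (4 * (δ ^ 2 / 40 * L)) := by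
      calc (8 * l : ℝ) ≤ (d : ℝ) ^ 4 := by exact_mod_cast eight_mul_clog_two_le hd
        _ = Real.exp (4 * Real.log d) := by
            rw [← Real.exp_log hd0, ← Real.exp_nat_mul, Real.exp_log hd0]
            norm_num
        _ ≤ _ := by gcongr
    calc ((4 * l : ℕ) : ℝ) * (2 * (Real.exp L * Real.exp (-(δ ^ 2 / 8) * L)))
        = (8 * l) * Real.exp (L + -(δ ^ 2 / 8) * L) := by
          rw [Real.exp_add]
          push_cast
          ring
      _ ≤ Real.exp (4 * (δ ^ 2 / 40 * L)) * Real.exp (L + -(δ ^ 2 / 8) * L) := by gcongr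
      _ = Real.exp (L * (1 - δ ^ 2 / 40)) := by
          rw [← Real.exp_add]
          congr 1
          ring
  · have hdt : (d : ℝ) / (d / δ) = δ := by field_simp
    rw [hdt, Real.rpow_def_of_pos (by linarith), ← Real.exp_add, ← Real.exp_nat_mul]
    refine Real.exp_le_exp.2 ?_
    calc ((4 * l : ℕ) : ℝ) * (Real.log (d / δ) * (2 * δ * L) + 2 * δ * L)
        = L * (4 * l * (2 * δ * (1 + Real.log (d / δ)))) := by push_cast; ring
      _ ≤ L * ε := by gcongr

/-- In the choice of `δ`, one factor `D` pays for the number of block factors and `D * E` for `1 +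
log (d / δ)`. -/
theorem mul_one_add_log_div_le {ε D E d l : ℝ} (hε : 0 < ε) (hd : 0 < d)
    (hD : D = Real.log d) (hE : E = Real.log (2 / ε)) (hD2 : 1 / 2 ≤ D) (hE2 : 1 / 2 ≤ E)
    (hl0 : 0 ≤ l) (hl : l ≤ 3 * D) :
    4 * l * (2 * (Real.exp (-12) * ε / (D ^ 2 * E)) *
      (1 + Real.log (d / (Real.exp (-12) * ε / (D ^ 2 * E))))) ≤ ε := by
  have hD0 : 0 < D := by linarith
  have hE0 : 0 < E := by linarith
  have hlog : Real.log (d / (Real.exp (-12) * ε / (D ^ 2 * E))) =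
      D + 12 - Real.log ε + 2 * Real.log D + Real.log E := by
    rw [Real.log_div hd.ne' (by positivity), Real.log_div (by positivity) (by positivity),
      Real.log_mul (by positivity) hε.ne', Real.log_mul (by positivity) hE0.ne', Real.log_exp,
      Real.log_pow, hD]
    push_cast
    ring
  have hlε : -Real.log ε ≤ E := by
    rw [hE, Real.log_div (by norm_num) hε.ne']
    linarith [Real.log_nonneg (by norm_num : (1 : ℝ) ≤ 2)]
  have h1 := Real.log_le_self hD0.le
  have h2 := Real.log_le_self hE0.le
  -- The left side is at most `3 * D + 2 * E + 13`; use `D ≤ 2 * D * E`, `E ≤ 2 * D * E` and `1 ≤ 4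
  -- * D * E`.
  have hDE : 1 + Real.log (d / (Real.exp (-12) * ε / (D ^ 2 * E))) ≤ 62 * (D * E) := by
    rw [hlog]
    nlinarith [mul_nonneg (sub_nonneg.2 hD2) (sub_nonneg.2 hE2)]
  have hexp : Real.exp (-12) * 1488 ≤ 1 := by
    rw [Real.exp_neg, inv_mul_le_iff₀ (Real.exp_pos _), mul_one]
    have h : (2 : ℝ) ≤ Real.exp 1 := by linarith [Real.add_one_le_exp (1 : ℝ)]
    calc (1488 : ℝ) ≤ 2 ^ 12 := by norm_num
      _ ≤ Real.exp 1 ^ 12 := by gcongr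
      _ = Real.exp 12 := by rw [← Real.exp_nat_mul]; norm_num
  have hδ : 0 < Real.exp (-12) * ε / (D ^ 2 * E) := by positivity
  set δ := Real.exp (-12) * ε / (D ^ 2 * E) with hδdef
  calc 4 * l * (2 * δ * (1 + Real.log (d / δ)))
      ≤ 4 * l * (2 * δ * (62 * (D * E))) := by gcongr
    _ ≤ 4 * (3 * D) * (2 * δ * (62 * (D * E))) := by gcongr
    _ = Real.exp (-12) * 1488 * ε := by
        rw [hδdef]
        field_simp
        ring
    _ ≤ 1 * ε := by gcongr
    _ = ε := one_mul ε

theorem corollary5p2 :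
    ∃ C : ℝ, 0 < C ∧
      ∀ (ε c : ℝ) (d : ℕ), 0 < ε → ε ≤ 1 → 0 < c → c ≤ 1 → 2 ≤ d →
        ∃ γ : ℝ,
          C * (c * ε ^ 2 /
            (d * Real.log d * Real.log (2 / c) * Real.log (2 / (c * ε)) ^ 2)) ≤ γ ∧
          ∀ (F : Type*) [Field F] (k : ℕ) (s : Fin k → ℕ)
            (M : ∀ i, Matrix (Fin (s i)) (Fin (s i)) F) (n : ℕ),
            (∀ i, c * d ≤ s i ∧ s i ≤ d) →
            n = ∏ i, s i →
            (d : ℝ) ^ (1 / γ) ≤ n →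
            (rcRigidity (kroneckerProd M) ((n : ℝ) ^ (1 - γ)) : ℝ) ≤ (n : ℝ) ^ ε := by
  -- Here `480 = 40 * 6 * 2`: the `40` from `γ = δ ^ 2 / 40`, the `6` from `D ^ 3 ≤ 6 * d`, the `2`
  -- from `log (2 / c) ≥ 1 / 2`.
  refine ⟨Real.exp (-12) ^ 2 / 480, by positivity, ?_⟩
  intro ε c d hε hε1 hc hc1 hd
  have half_le : ∀ x : ℝ, 2 ≤ x → 1 / 2 ≤ Real.log x := fun x hx => by
    have := Real.log_le_log (by norm_num) hx
    linarith [Real.log_two_gt_d9]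
  have hd0 : (0 : ℝ) < d := by positivity
  have hlc : 1 / 2 ≤ Real.log (2 / c) :=
    half_le _ (by rw [le_div_iff₀ hc]; linarith)
  obtain ⟨D, hD⟩ : ∃ D, D = Real.log d := ⟨_, rfl⟩
  obtain ⟨E, hE⟩ : ∃ E, E = Real.log (2 / ε) := ⟨_, rfl⟩
  have hD2 : 1 / 2 ≤ D := hD ▸ half_le_log_natCast hd
  have hE2 : 1 / 2 ≤ E := hE ▸ half_le _ (by rw [le_div_iff₀ hε]; linarith)
  have hD0 : 0 < D := by linarith
  have hE0 : 0 < E := by linarith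
  have hlce : E ≤ Real.log (2 / (c * ε)) := by
    rw [hE]
    apply Real.log_le_log (by positivity)
    gcongr
    exact mul_le_of_le_one_left hε.le hc1
  have ha1 : Real.exp (-12) ≤ 1 / 8 := by
    rw [Real.exp_neg, one_div]
    refine inv_anti₀ (by norm_num) ?_
    linarith [Real.add_one_le_exp (12 : ℝ)]
  have hδ0 : 0 < Real.exp (-12) * ε / (D ^ 2 * E) := by positivity
  have hδ1 : Real.exp (-12) * ε / (D ^ 2 * E) ≤ 1 := by
    rw [div_le_one (by positivity)]
    calc Real.exp (-12) * ε ≤ 1 / 8 * 1 := by gcongr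
      _ = (1 / 2) ^ 2 * (1 / 2) := by norm_num
      _ ≤ D ^ 2 * E := by gcongr
  have hmain := mul_one_add_log_div_le hε hd0 hD hE hD2 hE2 (Nat.cast_nonneg _)
    (hD ▸ clog_two_le_three_mul_log hd)
  refine ⟨(Real.exp (-12) * ε / (D ^ 2 * E)) ^ 2 / 40, ?_, ?_⟩
  · rw [← hD]
    have hD3 : D ^ 3 ≤ 6 * d := by
      have := Real.pow_div_factorial_le_exp D hD0.le 3
      rw [hD, Real.exp_log hd0, ← hD] at this
      norm_num [Nat.factorial] at this
      linarith
    calc Real.exp (-12) ^ 2 / 480 *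
          (c * ε ^ 2 / (d * D * Real.log (2 / c) * Real.log (2 / (c * ε)) ^ 2))
        ≤ Real.exp (-12) ^ 2 / 480 * (1 * ε ^ 2 / (D ^ 3 / 6 * D * (1 / 2) * E ^ 2)) := by
          gcongr
          linarith
      _ = (Real.exp (-12) * ε / (D ^ 2 * E)) ^ 2 / 40 := by
          field_simp
          norm_num
  · intro F _ k s M n hs hn hnd
    subst hn
    refine (hasRC_kroneckerProd (fun i => ?_) (fun i => (hs i).2) hd M hδ0 hδ1 hmain
      hnd).rcRigidity_le (by positivity)
    have : (0 : ℝ) < s i := lt_of_lt_of_le (by positivity) (hs i).1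
    exact_mod_cast this
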